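/- Let $\Gamma=6\tilde A_3$ be the disjoint union of six $4$-cycles (with simple edges). For integers $n,d>0$ let $$F=\mathcal F_{2n}^d(\Gamma):=(\mathbb Z\Gamma\oplus\mathbb Z h)/\ker,\qquad h^2=2n,\quad h\cdot v=d,\quad v^2=-2\ \ (v\in\Gamma),$$ where, for distinct vertices $u,v$, $u\cdot v$ is the multiplicity of the edge joining them, and $\ker$ is the radical of the bilinear form. A polarized lattice $S\ni h$ is an even non-degenerate lattice with positive inertia index $1$ and a distinguished vector $h$ with $h^2>0$. It is called *admissible* if there is no $e\in S$ with $e^2=-2$, $e\cdot h=0$ and no $e\in S$ with $e^2=0$, $e\cdot h=2$; it is *geometric* if, in addition, it admits a primitive isometry into the K3-lattice $2E_8\oplus 3U$ (with $E_8$ negative definite and $U$ the hyperbolic plane). If moreover $\Gamma\subset\{r\in S: r^2=-2,\ r\cdot h=d\}$ and there is no $e\in S$ with $e^2=-2$, $1\le e\cdot h<d$ and $e\cdot v<0$ for some $v\in\Gamma$, then $S$ is called *$\Gamma$-admissible* (respectively, *$\Gamma$-geometric*). The graph $\Gamma$ is *subgeometric in degree $2n$ with respect to $d$* if $F\ni h$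 is $\Gamma$-admissible and, for some subgroup $K\subset F^\vee/F$ isotropic for the $\mathbb Q/2\mathbb Z$-valued discriminant quadratic form, the finite index extension of $F$ by $K$ (the preimage of $K$ in $F^\vee$) is $\Gamma$-geometric. **Statement.** For every odd integer $d>1$ there is an integer $N$, depending only on $d$, such that for all odd integers $n\ge N$ the graph $6\tilde A_3$ is not subgeometric in degree $2n$ with respect to $d$. -/

import Mathlib

open LinearMap (BilinForm)

noncomputable section

/-! ### Lattices in rational quadratic spaces

A lattice is a `ℤ`-submodule `S` of a rational vector space `W` with a bilinear form `B`; thus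
`W` plays the role of `S ⊗ ℚ`. -/

section Lattices

variable {W : Type*} [AddCommGroup W] [Module ℚ W]

/-- `S ∋ h` is a polarized lattice: an even non-degenerate lattice of full rank in `W`,
hyperbolic (positive inertia index equal to `1`), with a distinguished vector `h`, `h² > 0`.
Since `h² > 0`, hyperbolicity means that the form is negative definite on the orthogonal
complement of `h`. -/
structure IsPolarizedLattice (B : BilinForm ℚ W) (S : Submodule ℤ W) (h : W) : Prop where
  fg : S.FG
  span_eq_top : Submodule.span ℚ (S : Set W) = ⊤
  symm : B.IsSymm
  even : ∀ x ∈ S, ∃ m : ℤ, B x x = 2 * (m : ℚ)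
  nondegenerate : B.Nondegenerate
  mem : h ∈ S
  pos : 0 < B h h
  hyperbolic : ∀ x : W, B x h = 0 → x ≠ 0 → B x x < 0

/-- The vectors `r ∈ S` with `r² = -2` and `r · h = d`. -/
def rootSet (B : BilinForm ℚ W) (S : Submodule ℤ W) (h : W) (d : ℕ) : Set W :=
  {r | r ∈ S ∧ B r r = -2 ∧ B r h = (d : ℚ)}

/-- Admissible polarized lattices: no exceptional divisors and no `2`-isotropic vectors. -/
structure IsAdmissible (B : BilinForm ℚ W) (S : Submodule ℤ W) (h : W) : Prop where
  polarized : IsPolarizedLattice B S h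
  no_exceptional : ¬ ∃ e ∈ S, B e e = -2 ∧ B e h = 0
  no_two_isotropic : ¬ ∃ e ∈ S, B e e = 0 ∧ B e h = 2

/-- The Gram matrix of the K3-lattice `2E₈ ⊕ 3U`, where `E₈` is negative definite and `U` is the
hyperbolic plane. -/
def k3Gram : Matrix ((Fin 8 × Fin 2) ⊕ (Fin 2 × Fin 3)) ((Fin 8 × Fin 2) ⊕ (Fin 2 × Fin 3)) ℤ :=
  Matrix.fromBlocks (Matrix.blockDiagonal fun _ : Fin 2 => -CartanMatrix.E₈) 0
    0 (Matrix.blockDiagonal fun _ : Fin 3 => !![0, 1; 1, 0])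

/-- The underlying group of the K3-lattice. -/
abbrev K3Lattice : Type := (Fin 8 × Fin 2) ⊕ (Fin 2 × Fin 3) → ℤ

/-- The intersection form of the K3-lattice. -/
def k3Form : BilinForm ℤ K3Lattice := Matrix.toBilin' k3Gram

/-- `S` admits a primitive isometry into the K3-lattice: an injective homomorphism that preserves
the form and has torsion free cokernel. -/
def HasPrimitiveIsometryToK3 (B : BilinForm ℚ W) (S : Submodule ℤ W) : Prop :=
  ∃ f : S →ₗ[ℤ] K3Lattice, Function.Injective f ∧
    (∀ x y : S, ((k3Form (f x) (f y) : ℤ) : ℚ) = B (x : W) (y : W)) ∧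
    ∀ (m : ℤ) (y : K3Lattice), m ≠ 0 → m • y ∈ LinearMap.range f → y ∈ LinearMap.range f

/-- Geometric lattices: admissible and primitively embeddable into the K3-lattice. -/
def IsGeometric (B : BilinForm ℚ W) (S : Submodule ℤ W) (h : W) : Prop :=
  IsAdmissible B S h ∧ HasPrimitiveIsometryToK3 B S

/-- There are no `Γ`-inadmissible roots: no `e` of degree `1 ≤ r < d` in `rootSet` with `e · v < 0`
for some `v ∈ Γ`. -/
def NoInadmissibleRoot (B : BilinForm ℚ W) (S : Submodule ℤ W) (h : W) (d : ℕ)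
    (Γ : Set W) : Prop :=
  ∀ r : ℕ, 1 ≤ r → r < d → ¬ ∃ e ∈ rootSet B S h r, ∃ v ∈ Γ, B e v < 0

/-- `Γ`-admissible lattices, for a set `Γ` of roots of degree `d`. -/
def IsGraphAdmissible (B : BilinForm ℚ W) (S : Submodule ℤ W) (h : W) (d : ℕ)
    (Γ : Set W) : Prop :=
  Γ ⊆ rootSet B S h d ∧ IsAdmissible B S h ∧ NoInadmissibleRoot B S h d Γ

/-- `Γ`-geometric lattices, for a set `Γ` of roots of degree `d`. -/
def IsGraphGeometric (B : BilinForm ℚ W) (S : Submodule ℤ W) (h : W) (d : ℕ)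
    (Γ : Set W) : Prop :=
  Γ ⊆ rootSet B S h d ∧ IsGeometric B S h ∧ NoInadmissibleRoot B S h d Γ

/-- The dual lattice `{x ∈ N ⊗ ℚ | x · y ∈ ℤ for all y ∈ N}`. -/
abbrev dualLattice (B : BilinForm ℚ W) (N : Submodule ℤ W) : Submodule ℤ W :=
  B.dualSubmodule N

/-- The discriminant group: the quotient of the dual lattice by the lattice. -/
abbrev Discr (B : BilinForm ℚ W) (N : Submodule ℤ W) : Type _ :=
  dualLattice B N ⧸ N.comap (dualLattice B N).subtype

/-- The discriminant class of a vector of the dual lattice. -/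
abbrev discrClass (B : BilinForm ℚ W) (N : Submodule ℤ W) : dualLattice B N →ₗ[ℤ] Discr B N :=
  (N.comap (dualLattice B N).subtype).mkQ

/-- A subgroup of the discriminant group is isotropic (a *kernel*) if the `ℚ/2ℤ`-valued
discriminant quadratic form `x mod N ↦ x² mod 2ℤ` vanishes on it. -/
def IsIsotropicKernel (B : BilinForm ℚ W) (N : Submodule ℤ W) (K : Submodule ℤ (Discr B N)) :
    Prop :=
  ∀ x : dualLattice B N, discrClass B N x ∈ K → ∃ m : ℤ, B (x : W) (x : W) = 2 * (m : ℚ)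

/-- The extension `N' ⊇ N` by a kernel `K = N'/N`: the preimage of `K` in the dual lattice. It is
of finite index whenever `N` is a non-degenerate lattice. -/
def latticeExtension (B : BilinForm ℚ W) (N : Submodule ℤ W) (K : Submodule ℤ (Discr B N)) :
    Submodule ℤ W :=
  (K.comap (discrClass B N)).map (dualLattice B N).subtype

end Lattices

/-! ### Graphs and their lattices -/

/-- A loop-free multigraph: `mult u v` is the multiplicity of the edge between `u` and `v`. -/
structure LoopFreeMultigraph (V : Type*) where
  mult : V → V → ℕ
  symm : ∀ u v, mult u v = mult v u
  loopless : ∀ v, mult v v = 0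

namespace LoopFreeMultigraph

variable {V : Type*} [Fintype V] [DecidableEq V]

/-- The Gram matrix of `ℤΓ + ℤh`; the generator `h` is `none` and the vertices are `some v`. One
has `h² = D`, `h · v = d`, `v² = -2`, and `u · v` is the multiplicity of the edge for `u ≠ v`. -/
def gram (Γ : LoopFreeMultigraph V) (D d : ℕ) : Matrix (Option V) (Option V) ℚ
  | none, none => (D : ℚ)
  | none, some _ => (d : ℚ)
  | some _, none => (d : ℚ)
  | some u, some v => if u = v then -2 else (Γ.mult u v : ℚ)

/-- The bilinear form of `ℤΓ + ℤh`, extended to `(ℤΓ + ℤh) ⊗ ℚ`. -/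
def preForm (Γ : LoopFreeMultigraph V) (D d : ℕ) : BilinForm ℚ (Option V → ℚ) :=
  Matrix.toBilin' (Γ.gram D d)

theorem preForm_symm (Γ : LoopFreeMultigraph V) (D d : ℕ) (x y : Option V → ℚ) :
    Γ.preForm D d x y = Γ.preForm D d y x := by
  have hg : ∀ i j, Γ.gram D d i j = Γ.gram D d j i := by
    intro i j
    rcases i with _ | u <;> rcases j with _ | v <;> simp only [gram]
    rw [Γ.symm u v]
    simp only [eq_comm]
  simp only [preForm, Matrix.toBilin'_apply]
  rw [Finset.sum_comm]
  refine Finset.sum_congr rfl fun i _ => Finset.sum_congr rfl fun j _ => ?_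
  rw [hg j i]; ring

/-- The rational quadratic space `Fano(Γ) ⊗ ℚ`: the quotient of `(ℤΓ + ℤh) ⊗ ℚ` by the radical. -/
abbrev FanoSpace (Γ : LoopFreeMultigraph V) (D d : ℕ) : Type _ :=
  (Option V → ℚ) ⧸ LinearMap.ker (Γ.preForm D d)

/-- The form induced on `Fano(Γ) ⊗ ℚ`. -/
def fanoForm (Γ : LoopFreeMultigraph V) (D d : ℕ) : BilinForm ℚ (Γ.FanoSpace D d) :=
  LinearMap.liftQ₂ _ _ (Γ.preForm D d) le_rfl (by
    intro x hx
    rw [LinearMap.mem_ker] at hx ⊢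
    refine LinearMap.ext fun y => ?_
    rw [LinearMap.flip_apply, Γ.preForm_symm D d y x]
    exact LinearMap.congr_fun hx y)

/-- The images in `Fano(Γ)` of the generators: `h` (for `none`) and the vertices (for `some v`). -/
def fanoGen (Γ : LoopFreeMultigraph V) (D d : ℕ) (i : Option V) : Γ.FanoSpace D d :=
  Submodule.Quotient.mk (Pi.single i 1)

/-- The lattice `Fano(Γ) = (ℤΓ + ℤh)/ker`, with `h² = D` and `h · v = d` for all `v ∈ Γ`. -/
def fanoLattice (Γ : LoopFreeMultigraph V) (D d : ℕ) : Submodule ℤ (Γ.FanoSpace D d) :=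
  Submodule.span ℤ (Set.range (Γ.fanoGen D d))

/-- The set of vertices of `Γ`, regarded as vectors in `Fano(Γ)`. -/
def fanoVertices (Γ : LoopFreeMultigraph V) (D d : ℕ) : Set (Γ.FanoSpace D d) :=
  Set.range fun v : V => Γ.fanoGen D d (some v)

/-- `Γ` is admissible in degree `D` with respect to `d`. -/
def IsAdmissibleInDegree (Γ : LoopFreeMultigraph V) (D d : ℕ) : Prop :=
  IsGraphAdmissible (Γ.fanoForm D d) (Γ.fanoLattice D d) (Γ.fanoGen D d none) d
    (Γ.fanoVertices D d)

/-- `Γ` is subgeometric in degree `D` with respect to `d`: it is admissible and `Fano(Γ)` has a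
`Γ`-geometric finite index extension. -/
def IsSubgeometric (Γ : LoopFreeMultigraph V) (D d : ℕ) : Prop :=
  Γ.IsAdmissibleInDegree D d ∧
    ∃ K : Submodule ℤ (Discr (Γ.fanoForm D d) (Γ.fanoLattice D d)),
      IsIsotropicKernel (Γ.fanoForm D d) (Γ.fanoLattice D d) K ∧
      IsGraphGeometric (Γ.fanoForm D d)
        (latticeExtension (Γ.fanoForm D d) (Γ.fanoLattice D d) K) (Γ.fanoGen D d none) d
        (Γ.fanoVertices D d)

/-- The disjoint union of `m` copies of a graph. -/
def copies {U : Type*} (m : ℕ) (Γ : LoopFreeMultigraph U) :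
    LoopFreeMultigraph (Fin m × U) where
  mult a b := if a.1 = b.1 then Γ.mult a.2 b.2 else 0
  symm a b := by simp only [eq_comm, Γ.symm a.2 b.2]
  loopless a := by simp [Γ.loopless]

/-- The affine Dynkin diagram `Ã₃`: a cycle with four vertices and simple edges. -/
def affineA3 : LoopFreeMultigraph (Fin 4) where
  mult r s := if s = r + 1 ∨ r = s + 1 then 1 else 0
  symm r s := by simp only [or_comm]
  loopless r := by revert r; decide

end LoopFreeMultigraph

end

open LinearMap (BilinForm)

noncomputable section

/-! ### The K3-lattice -/

/-! The obstruction is arithmetic modulo 4: an extension that is geometric forces `h² ≢ 2 mod 4`,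
whereas `h² = 2n` with `n` odd.

Let `S` be primitive in the unimodular K3-lattice `L`. By hyperbolicity the six quadrangles have a
common sum, the isotropic fibre class `k`. Admissibility makes `k` primitive in `L`
(`exists_form_k_eq_one`), so `k` lies in a hyperbolic plane `U`, and projecting three vertices of
each quadrangle to `U^⊥` gives `6A₃ ⊕ U ⊂ L`.

The words `c` with `∑ c i (a i 0 + a i 2) ∈ 2L` form a binary code of length 6. It is even, and a
word of weight two would produce an exceptional divisor (`opposite_ne_two_smul_add`); hence its
dimension is at most 2. As `6A₃ ⊕ U` has rank 20 in rank 22, duality modulo two forces dimension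
exactly 2 (`finrank_ker_codeMap_and_orthogonal`).

Consequently the form on `T = (6A₃ ⊕ U)^⊥`, of rank 2, is divisible by 4. Since 4 kills the
discriminant of `6A₃`, one fourth of this form is unimodular; it is also positive definite. So `T`
behaves as `4(x² + y²)`: a vector of square divisible by 16 lies in `2L`.

Finally, let `η` be the projection of `h` to `U^⊥`. If `h² ≡ 2 mod 4`, the component of `2η` in `T`,
corrected by a vector of `6A₃`, yields `t ∈ T` with `16 ∣ t²`. Then `t ∈ 2L` puts the all-one word
in the code, which would bring the dimension down to 1 (`not_form_self_two_mod_four`). -/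

theorem k3Gram_isSymm : k3Gram.IsSymm := by
  unfold k3Gram
  refine Matrix.IsSymm.fromBlocks ?_ (by simp) ?_
  · rw [Matrix.IsSymm, Matrix.blockDiagonal_transpose]
    simp [CartanMatrix.E₈_transpose]
  · rw [Matrix.IsSymm, Matrix.blockDiagonal_transpose]
    congr 1
    funext _
    decide

theorem isUnit_det_k3Gram : IsUnit k3Gram.det := by
  unfold k3Gram
  rw [Matrix.det_fromBlocks_zero₂₁, Matrix.det_blockDiagonal, Matrix.det_blockDiagonal]
  simp [Matrix.det_neg, CartanMatrix.E₈_det, Matrix.det_fin_two]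

theorem even_k3Gram_diag (i) : (k3Gram i i : ZMod 2) = 0 := by
  rcases i with ⟨i, j⟩ | ⟨i, j⟩
  · simp only [k3Gram, Matrix.fromBlocks_apply₁₁, Matrix.blockDiagonal_apply_eq, Matrix.neg_apply,
      CartanMatrix.E₈_diag]
    decide
  · simp only [k3Gram, Matrix.fromBlocks_apply₂₂, Matrix.blockDiagonal_apply_eq]
    fin_cases i <;> simp

theorem k3Form_comm (x y : K3Lattice) : k3Form x y = k3Form y x := by
  rw [k3Form, Matrix.toBilin'_apply', Matrix.toBilin'_apply', dotProduct_comm, 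
    ← Matrix.vecMul_transpose, k3Gram_isSymm, ← Matrix.dotProduct_mulVec]

/-- The K3-form modulo two. -/
def k3FormModTwo : BilinForm (ZMod 2) ((Fin 8 × Fin 2) ⊕ (Fin 2 × Fin 3) → ZMod 2) :=
  Matrix.toBilin' (k3Gram.map (Int.castRingHom (ZMod 2)))

/-- Reduction modulo two of the K3-lattice. -/
def k3Red : K3Lattice →+ ((Fin 8 × Fin 2) ⊕ (Fin 2 × Fin 3) → ZMod 2) where
  toFun x i := (x i : ZMod 2)
  map_zero' := by ext; simp
  map_add' x y := by ext; simp

theorem k3Red_eq_zero {x : K3Lattice} (hx : k3Red x = 0) : ∃ y : K3Lattice, x = (2 : ℤ) • y := by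
  have h : ∀ i, ∃ c : ℤ, x i = 2 * c := fun i =>
    (ZMod.intCast_zmod_eq_zero_iff_dvd (x i) 2).1 (congrFun hx i)
  choose y hy using h
  exact ⟨y, funext fun i => by simp [hy i]⟩

theorem k3Red_two_smul (x : K3Lattice) : k3Red ((2 : ℤ) • x) = 0 := by
  ext i
  simp [k3Red, show (2 : ZMod 2) = 0 from rfl]

theorem k3FormModTwo_red (x y : K3Lattice) :
    k3FormModTwo (k3Red x) (k3Red y) = (k3Form x y : ZMod 2) := by
  simp [k3FormModTwo, k3Form, Matrix.toBilin'_apply, k3Red]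

theorem k3FormModTwo_nondegenerate : k3FormModTwo.Nondegenerate := by
  refine LinearMap.BilinForm.nondegenerate_toBilin'_of_det_ne_zero' _ ?_
  rw [← RingHom.mapMatrix_apply, ← RingHom.map_det]
  exact (isUnit_det_k3Gram.map _).ne_zero

theorem even_k3Form (x : K3Lattice) : Even (k3Form x x) := by
  rw [even_iff_two_dvd, ← Nat.cast_two, ← ZMod.intCast_zmod_eq_zero_iff_dvd, k3Form,
    Matrix.toBilin'_apply, ← Fintype.sum_prod_type' fun i j => x i * k3Gram i j * x j, Int.cast_sum]
  -- Modulo two the terms `(i, j)` and `(j, i)` cancel, and the diagonal terms vanish.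
  refine Finset.sum_involution (fun p _ => p.swap) ?_ ?_ (by simp) (by simp)
  · rintro ⟨i, j⟩ -
    have h : k3Gram j i = k3Gram i j := k3Gram_isSymm.apply i j
    simp only [Prod.swap, h]
    rw [show x j * k3Gram i j * x i = x i * k3Gram i j * x j by ring]
    exact CharTwo.add_self_eq_zero _
  · rintro ⟨i, j⟩ - h he
    obtain rfl : j = i := congrArg Prod.fst he
    exact h (by simp [even_k3Gram_diag])

theorem k3Form_unimodular (g : K3Lattice →ₗ[ℤ] ℤ) : ∃ y, ∀ x, k3Form y x = g x := by
  refine ⟨Matrix.vecMul (fun i => g (Pi.single i 1)) k3Gram⁻¹, fun x => ?_⟩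
  rw [k3Form, Matrix.toBilin'_apply', Matrix.dotProduct_mulVec, Matrix.vecMul_vecMul,
    Matrix.nonsing_inv_mul _ isUnit_det_k3Gram, Matrix.vecMul_one, dotProduct]
  conv_rhs => rw [← (Pi.basisFun ℤ _).sum_repr x]
  simp only [map_sum, map_smul, Pi.basisFun_repr, Pi.basisFun_apply, smul_eq_mul, mul_comm]

/-- Three orthogonal vectors of square two in the K3-lattice. -/
theorem exists_k3_positive : ∃ p : Fin 3 → K3Lattice,
    ∀ i j, k3Form (p i) (p j) = if i = j then 2 else 0 := by
  refine ⟨fun i => Pi.single (Sum.inr (0, i)) 1 + Pi.single (Sum.inr (1, i)) 1, fun i j => ?_⟩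
  simp only [k3Form, map_add, LinearMap.add_apply, Matrix.toBilin'_single]
  simp [k3Gram, Matrix.blockDiagonal_apply]
  split_ifs <;> simp

/-! ### Binary codes of length six whose nonzero words have weight four or six -/

section Codes

variable (C : Submodule (ZMod 2) (Fin 6 → ZMod 2))

/-- An even word vanishing on the first three coordinates has weight 0 or 2, so a code without words
of weight two embeds in those coordinates. If it filled them, it would contain `100111` and
`010111`, whose sum has weight two. -/
theorem finrank_le_two_of_no_weight_two (he : ∀ x ∈ C, ∑ i, x i = 0)
    (h2 : ∀ i j, i ≠ j → (Pi.single i 1 + Pi.single j 1 : Fin 6 → ZMod 2) ∉ C) :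
    Module.finrank (ZMod 2) C ≤ 2 := by
  have h2' : ∀ x ∈ C, ∀ i j, i ≠ j → x ≠ Pi.single i 1 + Pi.single j 1 :=
    fun x hx i j hij h => h2 i j hij (h ▸ hx)
  let p : C →ₗ[ZMod 2] (Fin 3 → ZMod 2) :=
    (LinearMap.funLeft (ZMod 2) (ZMod 2) (Fin.castLE (by decide : 3 ≤ 6))).comp C.subtype
  have hp : ∀ x : C, ∀ i : Fin 3, p x i = x.1 (Fin.castLE (by decide) i) := fun _ _ => rfl
  have hinj : Function.Injective p := by
    rw [injective_iff_map_eq_zero]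
    intro x hx
    have key : ∀ y : Fin 6 → ZMod 2, ∑ i, y i = 0 →
        (∀ i j, i ≠ j → y ≠ Pi.single i 1 + Pi.single j 1) →
        y 0 = 0 → y 1 = 0 → y 2 = 0 → y = 0 := by decide +kernel
    exact Subtype.ext (key x.1 (he _ x.2) (h2' _ x.2) (congrFun hx 0) (congrFun hx 1)
      (congrFun hx 2))
  by_contra! h
  have hsurj : Function.Surjective p := by
    refine LinearMap.range_eq_top.1 (Submodule.eq_top_of_finrank_eq ?_)
    refine le_antisymm (Submodule.finrank_le _) ?_
    rw [LinearMap.finrank_range_of_inj hinj]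
    simpa [Nat.succ_le_iff] using h
  obtain ⟨x, hx⟩ := hsurj ![1, 0, 0]
  obtain ⟨y, hy⟩ := hsurj ![0, 1, 0]
  have keyx : ∀ y : Fin 6 → ZMod 2, ∑ i, y i = 0 →
      (∀ i j, i ≠ j → y ≠ Pi.single i 1 + Pi.single j 1) →
      y 0 = 1 → y 1 = 0 → y 2 = 0 → y = ![1, 0, 0, 1, 1, 1] := by decide +kernel
  have keyy : ∀ y : Fin 6 → ZMod 2, ∑ i, y i = 0 →
      (∀ i j, i ≠ j → y ≠ Pi.single i 1 + Pi.single j 1) →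
      y 0 = 0 → y 1 = 1 → y 2 = 0 → y = ![0, 1, 0, 1, 1, 1] := by decide +kernel
  have ex := keyx x.1 (he _ x.2) (h2' _ x.2) (congrFun hx 0) (congrFun hx 1) (congrFun hx 2)
  have ey := keyy y.1 (he _ y.2) (h2' _ y.2) (congrFun hy 0) (congrFun hy 1) (congrFun hy 2)
  refine h2' _ (C.add_mem x.2 y.2) 0 1 (by decide) ?_
  rw [ex, ey]
  decide +kernel

/-- Adding the all-one word turns weight four into weight two, so only the words 0 and 1 survive. -/
theorem finrank_le_one_of_one_mem (he : ∀ x ∈ C, ∑ i, x i = 0)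
    (h2 : ∀ i j, i ≠ j → (Pi.single i 1 + Pi.single j 1 : Fin 6 → ZMod 2) ∉ C)
    (h1 : (1 : Fin 6 → ZMod 2) ∈ C) : Module.finrank (ZMod 2) C ≤ 1 := by
  have h2' : ∀ x ∈ C, ∀ i j, i ≠ j → x ≠ Pi.single i 1 + Pi.single j 1 :=
    fun x hx i j hij h => h2 i j hij (h ▸ hx)
  have key : ∀ y : Fin 6 → ZMod 2, ∑ i, y i = 0 →
      (∀ i j, i ≠ j → y ≠ Pi.single i 1 + Pi.single j 1) →
      (∀ i j, i ≠ j → y + 1 ≠ Pi.single i 1 + Pi.single j 1) → y = 0 ∨ y = 1 := by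
    decide +kernel
  have hle : C ≤ Submodule.span (ZMod 2) {1} := fun x hx => by
    rcases key x (he x hx) (h2' x hx) (h2' _ (C.add_mem hx h1)) with rfl | rfl
    · exact zero_mem _
    · exact Submodule.mem_span_singleton_self _
  exact (Submodule.finrank_mono hle).trans (finrank_span_le_card _ |>.trans (by simp))

end Codes

/-! ### Six copies of `A₃` and a hyperbolic plane in the K3-lattice -/

/-- The Gram matrix of the negative definite root lattice `A₃`. -/
def gramA3 : Matrix (Fin 3) (Fin 3) ℤ := !![-2, 1, 0; 1, -2, 1; 0, 1, -2]

/-- The vectors `a i j` generate `6A₃`, the vectors `k`, `u` generate an orthogonal hyperbolic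
plane. -/
structure IsSixA3U (a : Fin 6 → Fin 3 → K3Lattice) (k u : K3Lattice) : Prop where
  aa : ∀ i j i' j', k3Form (a i j) (a i' j') = if i = i' then gramA3 j j' else 0
  ka : ∀ i j, k3Form k (a i j) = 0
  ua : ∀ i j, k3Form u (a i j) = 0
  kk : k3Form k k = 0
  uu : k3Form u u = 0
  ku : k3Form k u = 1

namespace IsSixA3U

variable {a : Fin 6 → Fin 3 → K3Lattice} {k u : K3Lattice}

/-- The orthogonal complement of `6A₃ ⊕ U`. -/
def orth (a : Fin 6 → Fin 3 → K3Lattice) (k u : K3Lattice) : Submodule ℤ K3Lattice where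
  carrier := {t | (∀ i j, k3Form t (a i j) = 0) ∧ k3Form t k = 0 ∧ k3Form t u = 0}
  zero_mem' := by simp
  add_mem' := by
    rintro x y ⟨h1, h2, h3⟩ ⟨h1', h2', h3'⟩
    simp [h1, h2, h3, h1', h2', h3']
  smul_mem' := by
    rintro c x ⟨h1, h2, h3⟩
    simp only [Set.mem_ofPred_eq, map_smul, LinearMap.smul_apply, h1, h2, h3, smul_zero, implies_true,
      and_self]

theorem mem_orth {t : K3Lattice} :
    t ∈ orth a k u ↔ (∀ i j, k3Form t (a i j) = 0) ∧ k3Form t k = 0 ∧ k3Form t u = 0 := Iff.rfl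

/-- The generators of `6A₃ ⊕ U` modulo two. -/
def genMap (a : Fin 6 → Fin 3 → K3Lattice) (k u : K3Lattice) :
    ((Fin 6 → Fin 3 → ZMod 2) × ZMod 2 × ZMod 2) →ₗ[ZMod 2]
      ((Fin 8 × Fin 2) ⊕ (Fin 2 × Fin 3) → ZMod 2) where
  toFun c := (∑ i, ∑ j, c.1 i j • k3Red (a i j)) + c.2.1 • k3Red k + c.2.2 • k3Red u
  map_add' x y := by simp [add_smul, Finset.sum_add_distrib]; abel
  map_smul' x y := by simp [mul_smul, Finset.smul_sum]

/-- The vectors `a i 0 + a i 2` modulo two. -/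
def codeMap (a : Fin 6 → Fin 3 → K3Lattice) :
    (Fin 6 → ZMod 2) →ₗ[ZMod 2] ((Fin 8 × Fin 2) ⊕ (Fin 2 × Fin 3) → ZMod 2) :=
  Fintype.linearCombination (ZMod 2) fun i => k3Red (a i 0 + a i 2)

theorem codeMap_apply (c : Fin 6 → ZMod 2) :
    codeMap a c = ∑ i, c i • k3Red (a i 0 + a i 2) := rfl

theorem codeMap_intCast (c : Fin 6 → ℤ) :
    codeMap a (fun i => (c i : ZMod 2)) = k3Red (∑ i, c i • (a i 0 + a i 2)) := by
  simp only [codeMap_apply, Int.cast_smul_eq_zsmul, map_sum, map_zsmul]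


/-! ### The binary code attached to `6A₃ ⊕ U` -/

theorem ak (h : IsSixA3U a k u) (i j) : k3Form (a i j) k = 0 := by rw [k3Form_comm, h.ka]

theorem au (h : IsSixA3U a k u) (i j) : k3Form (a i j) u = 0 := by rw [k3Form_comm, h.ua]

theorem uk (h : IsSixA3U a k u) : k3Form u k = 1 := by rw [k3Form_comm, h.ku]

theorem form_radical (h : IsSixA3U a k u) (i i' : Fin 6) (j : Fin 3) :
    k3Form (a i 0 + a i 2) (a i' j) = if i = i' then (if j = 1 then 2 else -2) else 0 := by
  rw [map_add, LinearMap.add_apply, h.aa, h.aa]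
  split_ifs with _ hj
  · subst hj; rfl
  · fin_cases j
    · rfl
    · exact absurd rfl hj
    · rfl
  · rfl

theorem form_radical_radical (h : IsSixA3U a k u) (i i' : Fin 6) :
    k3Form (a i 0 + a i 2) (a i' 0 + a i' 2) = if i = i' then -4 else 0 := by
  rw [map_add, h.form_radical, h.form_radical]
  split_ifs <;> simp_all

theorem mem_ker_codeMap_iff (c : Fin 6 → ℤ) :
    (fun i => (c i : ZMod 2)) ∈ LinearMap.ker (codeMap a) ↔
      ∃ y : K3Lattice, ∑ i, c i • (a i 0 + a i 2) = (2 : ℤ) • y := by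
  rw [LinearMap.mem_ker, codeMap_intCast]
  exact ⟨k3Red_eq_zero, fun ⟨y, hy⟩ => hy ▸ k3Red_two_smul y⟩

theorem exists_intCast_eq (x : Fin 6 → ZMod 2) : ∃ c : Fin 6 → ℤ, (fun i => (c i : ZMod 2)) = x :=
  ⟨fun i => (x i).val, by ext; simp⟩

theorem form_sum_radical (h : IsSixA3U a k u) (c c' : Fin 6 → ℤ) :
    k3Form (∑ i, c i • (a i 0 + a i 2)) (∑ i, c' i • (a i 0 + a i 2)) =
      -4 * ∑ i, c i * c' i := by
  simp only [map_sum, LinearMap.sum_apply, map_smul, LinearMap.smul_apply, h.form_radical_radical,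
    smul_eq_mul, Finset.mul_sum]
  refine Finset.sum_congr rfl fun i _ => ?_
  simp
  ring

/-- If the combination equals `2y`, comparing squares gives `y² = -∑ (c i)²`. As `y²` is even, so is
the weight. -/
theorem sum_eq_zero_of_mem_ker_codeMap (h : IsSixA3U a k u) (x : Fin 6 → ZMod 2)
    (hx : x ∈ LinearMap.ker (codeMap a)) : ∑ i, x i = 0 := by
  obtain ⟨c, rfl⟩ := exists_intCast_eq x
  obtain ⟨y, hy⟩ := (mem_ker_codeMap_iff c).1 hx
  have h1 := h.form_sum_radical c c
  rw [hy] at h1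
  simp only [map_smul, LinearMap.smul_apply, smul_eq_mul] at h1
  obtain ⟨m, hm⟩ := even_k3Form y
  have h2 : ∑ i, c i * c i = 2 * (-m) := by linarith
  have h3 := congrArg (Int.cast : ℤ → ZMod 2) h2
  push_cast at h3
  rw [show (2 : ZMod 2) = 0 from rfl, zero_mul] at h3
  rw [← h3]
  refine Finset.sum_congr rfl fun i _ => ?_
  change (c i : ZMod 2) = c i * c i
  generalize (c i : ZMod 2) = z
  revert z
  decide

theorem genMap_form_a (h : IsSixA3U a k u) (c) (i : Fin 6) (j : Fin 3) :
    k3FormModTwo (genMap a k u c) (k3Red (a i j)) = ∑ j', c.1 i j' * (gramA3 j' j : ZMod 2) := by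
  simp only [genMap, LinearMap.coe_mk, AddHom.coe_mk, map_add, map_sum, map_smul,
    LinearMap.add_apply, LinearMap.sum_apply, LinearMap.smul_apply, k3FormModTwo_red, h.aa, h.ka,
    h.ua, Int.cast_zero, smul_zero, add_zero]
  simp [smul_eq_mul, apply_ite]

theorem genMap_form_k (h : IsSixA3U a k u) (c) :
    k3FormModTwo (genMap a k u c) (k3Red k) = c.2.2 := by
  simp [genMap, k3FormModTwo_red, h.ak, h.kk, h.uk]

theorem genMap_form_u (h : IsSixA3U a k u) (c) :
    k3FormModTwo (genMap a k u c) (k3Red u) = c.2.1 := by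
  simp [genMap, k3FormModTwo_red, h.au, h.uu, h.ku]

/-- Vanishing combinations of the generators modulo two come from the code. -/
theorem eq_of_genMap_eq_zero (h : IsSixA3U a k u) {c} (hc : genMap a k u c = 0) (i : Fin 6) :
    c.1 i 1 = 0 ∧ c.1 i 2 = c.1 i 0 ∧ c.2 = 0 := by
  have h0 := h.genMap_form_a c i 0
  have h1 := h.genMap_form_a c i 1
  have hk := h.genMap_form_k c
  have hu := h.genMap_form_u c
  rw [hc] at h0 h1 hk hu
  simp only [map_zero, LinearMap.zero_apply, Fin.sum_univ_three, gramA3] at h0 h1 hk hu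
  -- Modulo two, pairing with `a i 0` reads off `c.1 i 1`, and pairing with `a i 1` gives `c.1 i 0 +
  -- c.1 i 2`: the radical of `A₃` is spanned by `a i 0 + a i 2`.
  simp [show (2 : ZMod 2) = 0 from rfl] at h0 h1
  refine ⟨h0.symm ▸ rfl, (CharTwo.add_eq_zero.1 h1.symm).symm, Prod.ext hu.symm hk.symm⟩

/-- The first coordinates of a combination of the generators of `6A₃ ⊕ U`. -/
def firstCoord : ((Fin 6 → Fin 3 → ZMod 2) × ZMod 2 × ZMod 2) →ₗ[ZMod 2] (Fin 6 → ZMod 2) where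
  toFun c i := c.1 i 0
  map_add' _ _ := rfl
  map_smul' _ _ := rfl

theorem finrank_ker_genMap_le (h : IsSixA3U a k u) :
    Module.finrank (ZMod 2) (LinearMap.ker (genMap a k u)) ≤
      Module.finrank (ZMod 2) (LinearMap.ker (codeMap a)) := by
  have hmem : ∀ c ∈ LinearMap.ker (genMap a k u), firstCoord c ∈ LinearMap.ker (codeMap a) := by
    intro c hc
    have h1 := h.eq_of_genMap_eq_zero hc
    rw [LinearMap.mem_ker] at hc ⊢
    rw [← hc, codeMap_apply, genMap]
    simp [Fin.sum_univ_three, (h1 _).1, (h1 _).2.1, (h1 0).2.2, firstCoord]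
  refine LinearMap.finrank_le_finrank_of_injective (f := firstCoord.restrict hmem) ?_
  rw [injective_iff_map_eq_zero]
  rintro ⟨c, hc⟩ h0
  have h1 := h.eq_of_genMap_eq_zero hc
  have h2 : ∀ i, c.1 i 0 = 0 := fun i => congrFun (congrArg Subtype.val h0) i
  refine Subtype.ext (Prod.ext (funext fun i => funext fun j => ?_) (h1 0).2.2)
  fin_cases j
  · exact h2 i
  · exact (h1 i).1
  · exact (h1 i).2.1.trans (h2 i)

theorem single_add_single_notMem_ker_codeMap
    (h2 : ∀ i j, i ≠ j → ¬ ∃ y : K3Lattice, a i 0 + a i 2 + (a j 0 + a j 2) = (2 : ℤ) • y)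
    (i j : Fin 6) (hij : i ≠ j) :
    (Pi.single i 1 + Pi.single j 1 : Fin 6 → ZMod 2) ∉ LinearMap.ker (codeMap a) := by
  intro hmem
  refine h2 i j hij ?_
  obtain ⟨y, hy⟩ := (mem_ker_codeMap_iff (a := a)
    (Pi.single i 1 + Pi.single j 1 : Fin 6 → ℤ)).1 (by
      convert hmem using 1
      ext l
      simp [Pi.single_apply])
  refine ⟨y, hy ▸ ?_⟩
  simp [add_smul, Finset.sum_add_distrib, Pi.single_apply, ite_smul]
  abel

/-- Both conclusions come from a single dimension count. The code vectors are orthogonal to all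
generators of `6A₃ ⊕ U` modulo two. If the code has dimension `δ ≤ 2`, they span a space of
dimension `6 - δ` inside an orthogonal complement of dimension at most `22 - (20 - δ) = 2 + δ`.
Hence `δ = 2`, and both spaces have dimension 4. -/
theorem finrank_ker_codeMap_and_orthogonal (h : IsSixA3U a k u)
    (h2 : ∀ i j, i ≠ j → ¬ ∃ y : K3Lattice, a i 0 + a i 2 + (a j 0 + a j 2) = (2 : ℤ) • y) :
    Module.finrank (ZMod 2) (LinearMap.ker (codeMap a)) = 2 ∧
      k3FormModTwo.orthogonal (LinearMap.range (genMap a k u)) = LinearMap.range (codeMap a) := by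
  have hle : LinearMap.range (codeMap a) ≤
      k3FormModTwo.orthogonal (LinearMap.range (genMap a k u)) := by
    rintro _ ⟨x, rfl⟩ _ ⟨c, rfl⟩
    obtain ⟨x, rfl⟩ := exists_intCast_eq x
    rw [codeMap_apply]
    simp only [map_sum, map_smul, map_add, h.genMap_form_a]
    refine Finset.sum_eq_zero fun i _ => ?_
    rw [Fin.sum_univ_three, Fin.sum_univ_three]
    generalize c.1 i 0 = c0
    generalize c.1 i 1 = c1
    generalize c.1 i 2 = c2
    generalize (x i : ZMod 2) = x
    revert c0 c1 c2 x
    decide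
  have hortho := LinearMap.BilinForm.finrank_orthogonal k3FormModTwo_nondegenerate
    (LinearMap.range (genMap a k u))
  have hfin := Submodule.finrank_mono hle
  have h1 := (codeMap a).finrank_range_add_finrank_ker
  have h3 := (genMap a k u).finrank_range_add_finrank_ker
  have h4 := h.finrank_ker_genMap_le
  have h5 : Module.finrank (ZMod 2) (LinearMap.ker (codeMap a)) ≤ 2 :=
    finrank_le_two_of_no_weight_two _ h.sum_eq_zero_of_mem_ker_codeMap
      (single_add_single_notMem_ker_codeMap h2)
  simp only [Module.finrank_prod, Module.finrank_pi_fintype, Module.finrank_self,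
    Finset.sum_const, Finset.card_univ, Fintype.card_fin, Fintype.card_sum, Fintype.card_prod,
    smul_eq_mul] at h1 h3 hortho
  refine ⟨by omega, (Submodule.eq_of_le_of_finrank_le hle (by omega)).symm⟩

/-! ### The orthogonal complement of `6A₃ ⊕ U` -/

theorem exists_eq_radical_add_two_smul (h : IsSixA3U a k u)
    (h2 : ∀ i j, i ≠ j → ¬ ∃ y : K3Lattice, a i 0 + a i 2 + (a j 0 + a j 2) = (2 : ℤ) • y)
    {t : K3Lattice} (ht : t ∈ orth a k u) :
    ∃ (c : Fin 6 → ℤ) (y : K3Lattice), t = ∑ i, c i • (a i 0 + a i 2) + (2 : ℤ) • y := by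
  have hmem : k3Red t ∈ LinearMap.range (codeMap a) := by
    rw [← (h.finrank_ker_codeMap_and_orthogonal h2).2]
    rintro _ ⟨c, rfl⟩
    obtain ⟨ha, hk, hu⟩ := ht
    simp only [genMap, LinearMap.coe_mk, AddHom.coe_mk, map_add, map_sum, map_smul,
      LinearMap.add_apply, LinearMap.sum_apply, LinearMap.smul_apply, k3FormModTwo_red,
      k3Form_comm _ t, ha, hk, hu, Int.cast_zero, smul_zero, add_zero, Finset.sum_const_zero]
  obtain ⟨x, hx⟩ := hmem
  obtain ⟨c, rfl⟩ := exists_intCast_eq x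
  rw [codeMap_intCast] at hx
  obtain ⟨y, hy⟩ := k3Red_eq_zero (x := t - ∑ i, c i • (a i 0 + a i 2)) (by
    rw [map_sub, hx, sub_self])
  exact ⟨c, y, by rw [← hy, add_sub_cancel]⟩

theorem form_sum_radical_eq_zero {t : K3Lattice} (ht : t ∈ orth a k u) (c : Fin 6 → ℤ) :
    k3Form t (∑ i, c i • (a i 0 + a i 2)) = 0 := by
  simp only [map_sum, map_smul, map_add, ht.1, add_zero, smul_zero, Finset.sum_const_zero]

/-- Write `t = r + 2y` and `t' = r' + 2y'` with `r`, `r'` combinations of the `a i 0 + a i 2`. Then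
`t · t' = 2 t · y' = 2 r · y' + 4 y · y'`, and `r · t' = 0` gives `2 r · y' = -r · r'`, a multiple
of 4. -/
theorem four_dvd_form (h : IsSixA3U a k u)
    (h2 : ∀ i j, i ≠ j → ¬ ∃ y : K3Lattice, a i 0 + a i 2 + (a j 0 + a j 2) = (2 : ℤ) • y)
    {t t' : K3Lattice} (ht : t ∈ orth a k u) (ht' : t' ∈ orth a k u) : 4 ∣ k3Form t t' := by
  obtain ⟨c, y, hy⟩ := h.exists_eq_radical_add_two_smul h2 ht
  obtain ⟨c', y', hy'⟩ := h.exists_eq_radical_add_two_smul h2 ht'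
  have h1 : k3Form t t' = 2 * k3Form t y' := by
    conv_lhs => rw [hy', map_add, form_sum_radical_eq_zero ht, map_smul, smul_eq_mul, zero_add]
  have h3 : k3Form t y' = k3Form (∑ i, c i • (a i 0 + a i 2)) y' + 2 * k3Form y y' := by
    conv_lhs => rw [hy, map_add, LinearMap.add_apply, map_smul, LinearMap.smul_apply, smul_eq_mul]
  have h4 := form_sum_radical_eq_zero ht' c
  rw [k3Form_comm, hy', map_add, h.form_sum_radical, map_smul, smul_eq_mul] at h4
  refine ⟨k3Form y y' + ∑ i, c i * c' i, ?_⟩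
  linarith

/-- Integral combinations of the vectors generating `6A₃`. -/
def comb (a : Fin 6 → Fin 3 → K3Lattice) : (Fin 6 → Fin 3 → ℤ) →ₗ[ℤ] K3Lattice where
  toFun x := ∑ i, ∑ j, x i j • a i j
  map_add' x y := by simp only [Pi.add_apply, add_smul, Finset.sum_add_distrib]
  map_smul' x y := by simp only [Pi.smul_apply, smul_assoc, Finset.smul_sum, RingHom.id_apply]

theorem comb_apply (x : Fin 6 → Fin 3 → ℤ) : comb a x = ∑ i, ∑ j, x i j • a i j := rfl

theorem form_comb (y : K3Lattice) (x : Fin 6 → Fin 3 → ℤ) :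
    k3Form y (comb a x) = ∑ i, ∑ j, x i j * k3Form y (a i j) := by
  simp only [comb_apply, map_sum, map_smul, smul_eq_mul]

theorem form_comb_a (h : IsSixA3U a k u) (x : Fin 6 → Fin 3 → ℤ) (i : Fin 6) (j : Fin 3) :
    k3Form (comb a x) (a i j) = ∑ j', x i j' * gramA3 j' j := by
  rw [k3Form_comm, form_comb, Finset.sum_eq_single i]
  · simp only [k3Form_comm (a i j), h.aa, if_true]
  · intro i' _ hi
    simp only [k3Form_comm (a i j), h.aa, if_neg hi, mul_zero, Finset.sum_const_zero]
  · simp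

theorem form_comb_k (h : IsSixA3U a k u) (x : Fin 6 → Fin 3 → ℤ) : k3Form (comb a x) k = 0 := by
  rw [k3Form_comm, form_comb]
  simp [h.ka]

theorem form_comb_u (h : IsSixA3U a k u) (x : Fin 6 → Fin 3 → ℤ) : k3Form (comb a x) u = 0 := by
  rw [k3Form_comm, form_comb]
  simp [h.ua]

theorem form_orth_comb {t : K3Lattice} (ht : t ∈ orth a k u) (x : Fin 6 → Fin 3 → ℤ) :
    k3Form t (comb a x) = 0 := by
  simp [form_comb, ht.1]

/-- Written as a sum of squares, the form on `6A₃` is visibly negative definite. -/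
theorem form_comb_self (h : IsSixA3U a k u) (x : Fin 6 → Fin 3 → ℤ) :
    k3Form (comb a x) (comb a x) =
      -∑ i, (x i 0 ^ 2 + (x i 0 - x i 1) ^ 2 + (x i 1 - x i 2) ^ 2 + x i 2 ^ 2) := by
  rw [form_comb, ← Finset.sum_neg_distrib]
  refine Finset.sum_congr rfl fun i _ => ?_
  simp only [h.form_comb_a, Fin.sum_univ_three, gramA3]
  simp
  ring

theorem comb_self_nonpos (h : IsSixA3U a k u) (x : Fin 6 → Fin 3 → ℤ) :
    k3Form (comb a x) (comb a x) ≤ 0 := by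
  rw [h.form_comb_self]
  exact neg_nonpos.2 (Finset.sum_nonneg fun i _ => by positivity)

theorem eq_zero_of_comb_self (h : IsSixA3U a k u) {x : Fin 6 → Fin 3 → ℤ}
    (hx : k3Form (comb a x) (comb a x) = 0) : x = 0 := by
  rw [h.form_comb_self, neg_eq_zero,
    Finset.sum_eq_zero_iff_of_nonneg fun i _ => by positivity] at hx
  funext i j
  have hi := hx i (Finset.mem_univ i)
  have h0 : x i 0 = 0 := by
    nlinarith [sq_nonneg (x i 0), sq_nonneg (x i 0 - x i 1), sq_nonneg (x i 1 - x i 2),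
      sq_nonneg (x i 2)]
  have h2 : x i 2 = 0 := by
    nlinarith [sq_nonneg (x i 0), sq_nonneg (x i 0 - x i 1), sq_nonneg (x i 1 - x i 2),
      sq_nonneg (x i 2)]
  have h1 : x i 1 = 0 := by
    rw [h0, h2] at hi
    nlinarith
  fin_cases j
  exacts [h0, h1, h2]

/-- The orthogonal complement of `6A₃ ⊕ U` is positive definite. -/
theorem form_self_pos (h : IsSixA3U a k u) {t : K3Lattice} (ht : t ∈ orth a k u) (h0 : t ≠ 0) :
    0 < k3Form t t := by
  by_contra! hneg
  obtain ⟨p, hp⟩ := exists_k3_positive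
  let P : (Fin 3 → ℤ) →ₗ[ℤ] K3Lattice := Fintype.linearCombination ℤ p
  have hP : ∀ c, k3Form (P c) (P c) = 2 * ∑ i, c i ^ 2 := by
    intro c
    simp only [P, Fintype.linearCombination_apply, map_sum, map_smul, LinearMap.sum_apply,
      LinearMap.smul_apply, hp, Finset.mul_sum, smul_eq_mul, mul_ite, mul_zero,
      Finset.sum_ite_eq', Finset.mem_univ, if_true]
    exact Finset.sum_congr rfl fun i _ => by ring
  -- If `t² ≤ 0`, three positive directions are independent of the negative semidefinite span of
  -- `6A₃`, `k - u` and `t`: this needs rank `3 + 18 + 1 + 1 = 23`, but the lattice has rank 22.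
  let F : ((Fin 3 → ℤ) × (Fin 6 → Fin 3 → ℤ) × ℤ × ℤ) →ₗ[ℤ] K3Lattice :=
    P.coprod ((comb a).coprod ((LinearMap.toSpanSingleton ℤ _ (k - u)).coprod
      (LinearMap.toSpanSingleton ℤ _ t)))
  have hF : ¬ Function.Injective F := by
    intro hinj
    have := LinearMap.finrank_le_finrank_of_injective hinj
    simp [Module.finrank_pi_fintype] at this
  refine hF ((injective_iff_map_eq_zero F).2 ?_)
  rintro ⟨c, x, e, g⟩ hz
  have hz' : P c = -(comb a x + (e • (k - u) + g • t)) := by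
    simpa [F, add_eq_zero_iff_eq_neg] using hz
  have hsq := hP c
  rw [hz'] at hsq
  simp only [map_neg, LinearMap.neg_apply, map_add, LinearMap.add_apply, map_smul, map_sub,
    LinearMap.smul_apply, LinearMap.sub_apply, smul_eq_mul, h.form_comb_k, h.form_comb_u,
    form_orth_comb ht, k3Form_comm _ (comb a x), ht.2.1, ht.2.2, h.kk, h.uu, h.ku,
    h.uk, k3Form_comm _ t] at hsq
  have hc := Finset.sum_nonneg fun i (_ : i ∈ Finset.univ) => sq_nonneg (c i)
  have hx := h.comb_self_nonpos x
  have hg : g * (g * k3Form t t) ≤ 0 := by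
    rw [← mul_assoc]
    exact mul_nonpos_of_nonneg_of_nonpos (mul_self_nonneg g) hneg
  have he : e = 0 := by nlinarith [sq_nonneg e]
  have hx0 : x = 0 := h.eq_zero_of_comb_self (by nlinarith [sq_nonneg e])
  have hc0 : c = 0 := by
    have : ∑ i, c i ^ 2 = 0 := by nlinarith [sq_nonneg e]
    rw [Finset.sum_eq_zero_iff_of_nonneg fun i _ => sq_nonneg _] at this
    exact funext fun i => by simpa using this i (Finset.mem_univ i)
  subst he hx0 hc0
  rw [map_zero, map_zero, zero_smul, zero_add, zero_add, eq_comm, neg_eq_zero] at hz'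
  rw [(smul_eq_zero.1 hz').resolve_right h0]
  rfl

/-- The products of a vector with the generators of `6A₃ ⊕ U`. -/
def products (a : Fin 6 → Fin 3 → K3Lattice) (k u : K3Lattice) :
    K3Lattice →ₗ[ℤ] (Fin 6 → Fin 3 → ℤ) × ℤ × ℤ :=
  (LinearMap.pi fun i => LinearMap.pi fun j => k3Form.flip (a i j)).prod
    ((k3Form.flip k).prod (k3Form.flip u))

theorem ker_products : LinearMap.ker (products a k u) = orth a k u := by
  ext t
  simp [products, mem_orth, funext_iff]

/-- The form on `6A₃ ⊕ U` is non-degenerate, so the 20 product functionals are independent, leaving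
rank `22 - 20`. -/
theorem finrank_orth (h : IsSixA3U a k u) : Module.finrank ℤ (orth a k u) = 2 := by
  rw [← ker_products]
  have h1 := (LinearMap.ker (products a k u)).finrank_quotient_add_finrank
  rw [(products a k u).quotKerEquivRange.finrank_eq] at h1
  let G : ((Fin 6 → Fin 3 → ℤ) × ℤ × ℤ) →ₗ[ℤ] K3Lattice :=
    (comb a).coprod ((LinearMap.toSpanSingleton ℤ _ k).coprod (LinearMap.toSpanSingleton ℤ _ u))
  have hinj : Function.Injective ((products a k u).rangeRestrict ∘ₗ G) := by
    rw [injective_iff_map_eq_zero]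
    rintro ⟨x, e, g⟩ hz
    have hz' : G (x, e, g) ∈ orth a k u := by
      rw [← ker_products]
      exact congrArg Subtype.val hz
    have hG : G (x, e, g) = comb a x + (e • k + g • u) := by simp [G]
    rw [hG] at hz'
    have hk := hz'.2.1
    have hu := hz'.2.2
    simp only [map_add, map_smul, LinearMap.add_apply, LinearMap.smul_apply, h.form_comb_k,
      h.form_comb_u, h.kk, h.ku, h.uk, h.uu, smul_eq_mul, mul_zero, mul_one, zero_add,
      add_zero] at hk hu
    subst hk hu
    rw [zero_smul, zero_smul, add_zero, add_zero] at hz'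
    rw [h.eq_zero_of_comb_self (form_orth_comb hz' x)]
    rfl
  have h2 := LinearMap.finrank_le_finrank_of_injective hinj
  have h3 := Submodule.finrank_le (LinearMap.range (products a k u))
  simp [Module.finrank_pi_fintype] at h1 h2 h3
  omega

/-- Every functional on `(6A₃ ⊕ U)^⊥` is represented by a vector of the K3-lattice. -/
theorem exists_form_eq_on_orth (f : orth a k u →ₗ[ℤ] ℤ) :
    ∃ y, ∀ t : orth a k u, k3Form y t = f t := by
  -- The range of `products` is free, so its kernel is a direct summand: `f` extends to the whole
  -- lattice, where unimodularity applies.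
  obtain ⟨s, hs⟩ := Module.projective_lifting_property (products a k u).rangeRestrict
    LinearMap.id (LinearMap.surjective_rangeRestrict _)
  have hs' : ∀ x, products a k u (s x) = x := fun x =>
    congrArg Subtype.val (LinearMap.congr_fun hs x)
  let q : K3Lattice →ₗ[ℤ] orth a k u :=
    (LinearMap.id - s ∘ₗ (products a k u).rangeRestrict).codRestrict _ fun x => by
      rw [← ker_products, LinearMap.mem_ker]
      simp [hs']
  obtain ⟨y, hy⟩ := k3Form_unimodular (f ∘ₗ q)
  refine ⟨y, fun t => ?_⟩
  rw [hy, LinearMap.comp_apply]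
  congr 1
  have ht : (products a k u).rangeRestrict (t : K3Lattice) = 0 := by
    refine Subtype.ext ?_
    exact (ker_products (a := a) (k := k) (u := u)).ge t.2
  refine Subtype.ext ?_
  simp [q, ht]

/-- The vector of `6A₃` with given products `4 * s i j` with the generators. -/
def fourDual (a : Fin 6 → Fin 3 → K3Lattice) (s : Fin 6 → Fin 3 → ℤ) : K3Lattice :=
  comb a fun i => ![-(3 * s i 0 + 2 * s i 1 + s i 2), -(2 * s i 0 + 4 * s i 1 + 2 * s i 2),
    -(s i 0 + 2 * s i 1 + 3 * s i 2)]

theorem form_fourDual_a (h : IsSixA3U a k u) (s : Fin 6 → Fin 3 → ℤ) (i j) :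
    k3Form (fourDual a s) (a i j) = 4 * s i j := by
  rw [fourDual, h.form_comb_a, Fin.sum_univ_three]
  fin_cases j <;> simp [gramA3] <;> ring

/-- One fourth of the form on `(6A₃ ⊕ U)^⊥` is unimodular. -/
theorem exists_orth_form_eq (h : IsSixA3U a k u) (f : orth a k u →ₗ[ℤ] ℤ) :
    ∃ t₀ : orth a k u, ∀ t : orth a k u, k3Form t₀ t = 4 * f t := by
  obtain ⟨y, hy⟩ := exists_form_eq_on_orth f
  let s : Fin 6 → Fin 3 → ℤ := fun i j => k3Form y (a i j)
  -- The projection of `y` to the complement becomes integral after multiplication by 4.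
  refine ⟨⟨(4 : ℤ) • y - fourDual a s - (4 * k3Form y u) • k - (4 * k3Form y k) • u, ?_, ?_, ?_⟩,
    fun t => ?_⟩
  · intro i j
    simp only [map_sub, map_smul, LinearMap.sub_apply, LinearMap.smul_apply, h.form_fourDual_a,
      h.ka, h.ua, s, smul_eq_mul]
    ring
  · simp only [map_sub, map_smul, LinearMap.sub_apply, LinearMap.smul_apply, fourDual,
      h.form_comb_k, h.kk, h.uk, smul_eq_mul]
    ring
  · simp only [map_sub, map_smul, LinearMap.sub_apply, LinearMap.smul_apply, fourDual,
      h.form_comb_u, h.uu, h.ku, smul_eq_mul]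
    ring
  · simp only [map_sub, map_smul, LinearMap.sub_apply, LinearMap.smul_apply, fourDual,
      k3Form_comm _ (t : K3Lattice), form_orth_comb t.2, t.2.2.1, t.2.2.2, smul_eq_mul]
    rw [k3Form_comm, hy]
    ring

/-- A vector of `(6A₃ ⊕ U)^⊥` with square divisible by `16` is divisible by two. -/
theorem exists_eq_two_smul_of_orth (h : IsSixA3U a k u)
    (h2 : ∀ i j, i ≠ j → ¬ ∃ y : K3Lattice, a i 0 + a i 2 + (a j 0 + a j 2) = (2 : ℤ) • y)
    {t : K3Lattice} (ht : t ∈ orth a k u) (h16 : 16 ∣ k3Form t t) :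
    ∃ y : K3Lattice, t = (2 : ℤ) • y := by
  let b := Module.finBasisOfFinrankEq ℤ (orth a k u) h.finrank_orth
  have hb : ∀ v : orth a k u, (v : K3Lattice) = b.repr v 0 • (b 0 : K3Lattice) +
      b.repr v 1 • (b 1 : K3Lattice) := fun v => by
    conv_lhs => rw [← b.sum_repr v, Fin.sum_univ_two]
    rfl
  obtain ⟨A, hA⟩ := h.four_dvd_form h2 (b 0).2 (b 0).2
  obtain ⟨B, hB⟩ := h.four_dvd_form h2 (b 0).2 (b 1).2
  obtain ⟨C, hC⟩ := h.four_dvd_form h2 (b 1).2 (b 1).2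
  have hB' : k3Form (b 1) (b 0) = 4 * B := by rw [k3Form_comm, hB]
  obtain ⟨e, he⟩ := h.exists_orth_form_eq (b.coord 0)
  obtain ⟨f, hf⟩ := h.exists_orth_form_eq (b.coord 1)
  have he0 := he (b 0)
  have he1 := he (b 1)
  have hf0 := hf (b 0)
  have hf1 := hf (b 1)
  rw [hb e] at he0 he1
  rw [hb f] at hf0 hf1
  simp only [map_add, map_smul, LinearMap.add_apply, LinearMap.smul_apply, hA, hB, hB', hC,
    smul_eq_mul, Module.Basis.coord_apply, Module.Basis.repr_self, Finsupp.single_apply]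
    at he0 he1 hf0 hf1
  simp at he0 he1 hf0 hf1
  generalize b.repr e 0 = e0 at *
  generalize b.repr e 1 = e1 at *
  generalize b.repr f 0 = f0 at *
  generalize b.repr f 1 = f1 at *
  have hne : ∀ i, (b i : K3Lattice) ≠ 0 := fun i hi => b.ne_zero i (Subtype.ext hi)
  have hApos : 0 < A := by
    have := h.form_self_pos (b 0).2 (hne 0)
    rw [hA] at this
    linarith
  have hdetpos : 0 < A * C - B ^ 2 := by
    -- This vector has square `4A(AC - B²)`, so positivity of the form gives positivity of the
    -- determinant.
    have hv : (A • (b 1) - B • (b 0) : orth a k u) ≠ 0 := fun h0 => by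
      have := congrArg (fun v => b.repr v 1) h0
      simp at this
      exact hApos.ne' this
    have := h.form_self_pos (A • (b 1) - B • (b 0) : orth a k u).2 (fun h0 => hv (Subtype.ext h0))
    simp only [Submodule.coe_sub, Submodule.coe_smul, map_sub, map_smul, LinearMap.sub_apply,
      LinearMap.smul_apply, hA, hB, hB', hC, smul_eq_mul] at this
    have h3 : 0 < 4 * A * (A * C - B ^ 2) := by linarith
    exact pos_of_mul_pos_right h3 (by linarith)
  have hdet : A * C - B ^ 2 = 1 := by
    -- The vectors `e`, `f` are dual to the basis for one fourth of the form, so their coordinates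
    -- invert its Gram matrix.
    have hmul : (A * C - B ^ 2) * (e0 * f1 - e1 * f0) = 1 := by
      have q1 : e0 * A + e1 * B = 1 := by linarith
      have q2 : e0 * B + e1 * C = 0 := by linarith
      have q4 : f0 * B + f1 * C = 1 := by linarith
      linear_combination (f0 * B + f1 * C) * q1 + q4 - (f0 * A + f1 * B) * q2
    rcases Int.isUnit_iff.1 (IsUnit.of_mul_eq_one _ hmul) with h1 | h1
    · exact h1
    · omega
  have htb := hb ⟨t, ht⟩
  simp only at htb
  generalize b.repr ⟨t, ht⟩ 0 = x at htb
  generalize b.repr ⟨t, ht⟩ 1 = y at htb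
  obtain ⟨m, hm⟩ := h16
  rw [htb] at hm
  simp only [map_add, map_smul, LinearMap.add_apply, LinearMap.smul_apply, hA, hB, hB', hC,
    smul_eq_mul] at hm
  have hq : A * x ^ 2 + 2 * B * x * y + C * y ^ 2 = 4 * m := by linarith
  have key : ∀ A B C x y : ZMod 4, A * C - B ^ 2 = 1 → A * x ^ 2 + 2 * B * x * y + C * y ^ 2 = 0 →
      2 * x = 0 ∧ 2 * y = 0 := by decide +kernel
  obtain ⟨hx, hy⟩ := key A B C x y (by exact_mod_cast congrArg (Int.cast : ℤ → ZMod 4) hdet) (by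
    have := congrArg (Int.cast : ℤ → ZMod 4) hq
    push_cast at this
    rw [this, show (4 : ZMod 4) = 0 from rfl, zero_mul])
  have hx' : (4 : ℤ) ∣ 2 * x := by
    rw [← Nat.cast_ofNat, ← ZMod.intCast_zmod_eq_zero_iff_dvd]
    exact_mod_cast hx
  have hy' : (4 : ℤ) ∣ 2 * y := by
    rw [← Nat.cast_ofNat, ← ZMod.intCast_zmod_eq_zero_iff_dvd]
    exact_mod_cast hy
  obtain ⟨x', rfl⟩ : ∃ x', x = 2 * x' := ⟨x / 2, by omega⟩
  obtain ⟨y', rfl⟩ : ∃ y', y = 2 * y' := ⟨y / 2, by omega⟩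
  exact ⟨x' • (b 0 : K3Lattice) + y' • (b 1 : K3Lattice), by
    rw [htb, smul_add, smul_smul, smul_smul]⟩

/-- A vector with odd products with the generators of `6A₃`, all congruent modulo four, and
orthogonal to the hyperbolic plane does not have square congruent to two modulo four. -/
theorem not_form_self_two_mod_four (h : IsSixA3U a k u)
    (h2 : ∀ i j, i ≠ j → ¬ ∃ y : K3Lattice, a i 0 + a i 2 + (a j 0 + a j 2) = (2 : ℤ) • y)
    {η : K3Lattice} {d : ℤ} (hd : Odd d) {s : Fin 6 → Fin 3 → ℤ}
    (hη : ∀ i j, k3Form η (a i j) = d + 4 * s i j) (hk : k3Form η k = 0) (hu : k3Form η u = 0)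
    (m : ℤ) : k3Form η η ≠ 4 * m + 2 := by
  intro hsq
  obtain ⟨r, hr⟩ := hd
  let ρ : K3Lattice := comb a fun _ => ![3, 4, 3]
  -- `ρ` has product `-2` with each generator, so `d • ρ` cancels the part `2d` of the products of
  -- `2η`, and `2 • fourDual a s` the part `8 * s i j`.
  let t : K3Lattice := (2 : ℤ) • η + d • ρ - (2 : ℤ) • fourDual a s
  have ht : t ∈ orth a k u := by
    refine ⟨fun i j => ?_, ?_, ?_⟩
    · have : k3Form ρ (a i j) = -2 := by
        rw [h.form_comb_a, Fin.sum_univ_three]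
        fin_cases j <;> simp [gramA3]
      simp only [t, map_add, map_sub, map_smul, LinearMap.add_apply, LinearMap.sub_apply,
        LinearMap.smul_apply, hη, this, h.form_fourDual_a, smul_eq_mul]
      ring
    · simp only [t, map_add, map_sub, map_smul, LinearMap.add_apply, LinearMap.sub_apply,
        LinearMap.smul_apply, hk, ρ, fourDual, h.form_comb_k, smul_eq_mul]
      ring
    · simp only [t, map_add, map_sub, map_smul, LinearMap.add_apply, LinearMap.sub_apply,
        LinearMap.smul_apply, hu, ρ, fourDual, h.form_comb_u, smul_eq_mul]
      ring
  have h1 : k3Form t t = 2 * k3Form η t := by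
    conv_lhs => arg 2; rw [show t = (2 : ℤ) • η + d • ρ - (2 : ℤ) • fourDual a s from rfl]
    rw [map_sub, map_add, map_smul, map_smul, map_smul, form_orth_comb ht, fourDual,
      form_orth_comb ht, k3Form_comm]
    simp
  have h3 : k3Form η ρ = 60 * d + ∑ i, 4 * (3 * s i 0 + 4 * s i 1 + 3 * s i 2) := by
    simp only [ρ, form_comb, hη, Fin.sum_univ_three, Fin.sum_univ_six]
    simp
    ring
  have h4 : k3Form η (fourDual a s) = -(∑ i, 2 * (3 * s i 0 + 4 * s i 1 + 3 * s i 2)) * d - 4 *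
      ∑ i, ((3 * s i 0 + 2 * s i 1 + s i 2) * s i 0 + (2 * s i 0 + 4 * s i 1 + 2 * s i 2) * s i 1 +
        (s i 0 + 2 * s i 1 + 3 * s i 2) * s i 2) := by
    simp only [fourDual, form_comb, hη, Fin.sum_univ_three, Finset.sum_mul, Finset.mul_sum,
      ← Finset.sum_neg_distrib, ← Finset.sum_sub_distrib]
    refine Finset.sum_congr rfl fun i _ => ?_
    simp
    ring
  simp only [← Finset.mul_sum] at h3 h4
  -- Modulo 16 the square is `8 + 120 d²`, which vanishes because `d` is odd.
  have h5 : 16 ∣ k3Form t t := by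
    rw [h1]
    simp only [t, map_add, map_sub, map_smul, smul_eq_mul, h3, h4, hsq, hr]
    generalize ∑ i, (3 * s i 0 + 4 * s i 1 + 3 * s i 2) = X
    generalize ∑ i, ((3 * s i 0 + 2 * s i 1 + s i 2) * s i 0 +
      (2 * s i 0 + 4 * s i 1 + 2 * s i 2) * s i 1 +
        (s i 0 + 2 * s i 1 + 3 * s i 2) * s i 2) = Y
    refine ⟨m + 1 + (2 * r + 1) * X + Y + 30 * r * (r + 1) + 7, ?_⟩
    ring
  obtain ⟨y, hy⟩ := h.exists_eq_two_smul_of_orth h2 ht h5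
  -- As `d = 2r + 1` and `t` is even, `ρ` is even too; its odd coefficients are those of `a i 0` and
  -- `a i 2`.
  have hmem : (1 : Fin 6 → ZMod 2) ∈ LinearMap.ker (codeMap a) := by
    have := (mem_ker_codeMap_iff (a := a) 1).2
      ⟨y - η + fourDual a s - r • ρ - ∑ i, (a i 0 + (2 : ℤ) • a i 1 + a i 2), by
        have e1 : (2 : ℤ) • y = (2 : ℤ) • η + (2 * r + 1) • ρ - (2 : ℤ) • fourDual a s := by
          rw [← hy, ← hr]
        have e2 : ρ = ∑ i, (a i 0 + a i 2) +
            (2 : ℤ) • ∑ i, (a i 0 + (2 : ℤ) • a i 1 + a i 2) := by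
          simp only [ρ, comb_apply, Fin.sum_univ_three, Finset.smul_sum, ← Finset.sum_add_distrib]
          refine Finset.sum_congr rfl fun i _ => ?_
          simp only [Matrix.cons_val]
          module
        simp only [Pi.one_apply, one_smul, smul_sub]
        linear_combination (exp := 1) -e1 - e2⟩
    convert this using 1
    funext i
    simp
  have := finrank_le_one_of_one_mem _ h.sum_eq_zero_of_mem_ker_codeMap
    (single_add_single_notMem_ker_codeMap h2) hmem
  rw [(h.finrank_ker_codeMap_and_orthogonal h2).1] at this
  omega

end IsSixA3U

/-! ### Six quadrangles in the K3-lattice -/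

/-- The intersection matrix of a quadrangle `Ã₃` of `(-2)`-vectors. -/
def gramAffineA3 : Matrix (Fin 4) (Fin 4) ℤ :=
  !![-2, 1, 0, 1; 1, -2, 1, 0; 0, 1, -2, 1; 1, 0, 1, -2]

/-- A vector of the K3-lattice is a multiple of a vector that has a product equal to `1`. -/
theorem exists_eq_smul_and_form_eq_one {k : K3Lattice} (hk : k ≠ 0) :
    ∃ (c : ℤ) (k' u : K3Lattice), 0 < c ∧ k = c • k' ∧ k3Form u k' = 1 := by
  obtain ⟨c, hc⟩ := (IsPrincipalIdealRing.principal (LinearMap.range (k3Form k))).principal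
  have hdvd : ∀ x, c ∣ k3Form k x := fun x => by
    have : k3Form k x ∈ LinearMap.range (k3Form k) := ⟨x, rfl⟩
    rw [hc] at this
    exact Ideal.mem_span_singleton.1 this
  obtain ⟨x, hx⟩ : c ∈ LinearMap.range (k3Form k) := hc ▸ Submodule.mem_span_singleton_self c
  have hcoord : ∀ i, ∃ m, k i = c * m := fun i => by
    obtain ⟨y, hy⟩ := k3Form_unimodular (LinearMap.proj i)
    have := hdvd y
    rwa [k3Form_comm, hy] at this
  choose k' hk' using hcoord
  have hkk : k = c • k' := funext hk'
  have hc0 : c ≠ 0 := by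
    rintro rfl
    exact hk (by rw [hkk, zero_smul])
  have hone : k3Form x k' = 1 := by
    rw [hkk, map_smul, LinearMap.smul_apply, smul_eq_mul, k3Form_comm] at hx
    exact mul_left_cancel₀ hc0 (hx.trans (mul_one c).symm)
  rcases hc0.lt_or_gt with hneg | hpos
  · exact ⟨-c, -k', -x, by omega, by rw [neg_smul_neg, hkk], by simpa using hone⟩
  · exact ⟨c, k', x, hpos, hkk, hone⟩

/-- Six disjoint quadrangles of degree `d` in the K3-lattice; `S` is a primitive sublattice
containing them and the polarization `h`. -/
structure IsSixQuadrangles (S : Submodule ℤ K3Lattice) (v : Fin 6 → Fin 4 → K3Lattice)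
    (h k : K3Lattice) (d : ℤ) : Prop where
  vv : ∀ i j i' j', k3Form (v i j) (v i' j') = if i = i' then gramAffineA3 j j' else 0
  vh : ∀ i j, k3Form (v i j) h = d
  sum_eq : ∀ i, v i 0 + v i 1 + v i 2 + v i 3 = k
  v_mem : ∀ i j, v i j ∈ S
  primitive : ∀ (m : ℤ) (y : K3Lattice), m ≠ 0 → m • y ∈ S → y ∈ S
  no_exceptional : ∀ e ∈ S, k3Form e e = -2 → k3Form e h ≠ 0
  no_inadmissible : ∀ e ∈ S, k3Form e e = -2 → 0 < k3Form e h → k3Form e h < d →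
    ∀ i j, 0 ≤ k3Form e (v i j)

namespace IsSixQuadrangles

variable {S : Submodule ℤ K3Lattice} {v : Fin 6 → Fin 4 → K3Lattice} {h k : K3Lattice} {d : ℤ}

theorem k_mem (Q : IsSixQuadrangles S v h k d) : k ∈ S := by
  rw [← Q.sum_eq 0]
  exact add_mem (add_mem (add_mem (Q.v_mem 0 0) (Q.v_mem 0 1)) (Q.v_mem 0 2)) (Q.v_mem 0 3)

theorem kv (Q : IsSixQuadrangles S v h k d) (i j) : k3Form k (v i j) = 0 := by
  rw [← Q.sum_eq i]
  simp only [map_add, LinearMap.add_apply, Q.vv, if_true]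
  fin_cases j <;> rfl

theorem vk (Q : IsSixQuadrangles S v h k d) (i j) : k3Form (v i j) k = 0 := by
  rw [k3Form_comm, Q.kv]

theorem kk (Q : IsSixQuadrangles S v h k d) : k3Form k k = 0 := by
  conv_lhs => arg 2; rw [← Q.sum_eq 0]
  simp only [map_add, Q.kv, add_zero]

theorem kh (Q : IsSixQuadrangles S v h k d) : k3Form k h = 4 * d := by
  rw [← Q.sum_eq 0]
  simp only [map_add, LinearMap.add_apply, Q.vh]
  ring

/-- The class of a fibre has a product equal to `1`. -/
theorem exists_form_k_eq_one (Q : IsSixQuadrangles S v h k d) (hd : 0 < d) :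
    ∃ u, k3Form u k = 1 := by
  have hk0 : k ≠ 0 := by
    rintro rfl
    have := Q.kh
    simp at this
    omega
  obtain ⟨c, k', u, hc, hk, hu⟩ := exists_eq_smul_and_form_eq_one hk0
  have hmem : k' ∈ S := Q.primitive c k' hc.ne' (hk ▸ Q.k_mem)
  have hkv : ∀ i j, k3Form k' (v i j) = 0 := fun i j => by
    have := Q.kv i j
    rw [hk, map_smul, LinearMap.smul_apply] at this
    exact (smul_eq_zero.1 this).resolve_left hc.ne'
  have hvk : ∀ i j, k3Form (v i j) k' = 0 := fun i j => by rw [k3Form_comm, hkv]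
  have hkk : k3Form k' k' = 0 := by
    have := Q.kk
    rw [hk, map_smul, map_smul, LinearMap.smul_apply] at this
    exact (smul_eq_zero.1 ((smul_eq_zero.1 this).resolve_left hc.ne')).resolve_left hc.ne'
  have hkh : c * k3Form k' h = 4 * d := by
    rw [← Q.kh, hk, map_smul, LinearMap.smul_apply, smul_eq_mul]
  have hpos : 0 < k3Form k' h := pos_of_mul_pos_right (hkh ▸ by omega) hc.le
  have hv : ∀ j j', k3Form (v 0 j) (v 0 j') = gramAffineA3 j j' := fun j j' => by simp [Q.vv]
  obtain rfl | hc1 : c = 1 ∨ 2 ≤ c := by omega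
  · exact ⟨u, by rw [hk, one_smul, hu]⟩
  exfalso
  -- The degree of `k'` is `4d / c`. For `c = 2`, `v 0 0 + v 0 1 - k'` is exceptional. For `c = 3`,
  -- `k' - v 0 0` has degree `d / 3` and product `-1` with `v 0 1`. For `c ≥ 4`, `v 0 0 - k'` has
  -- degree in `[0, d)` and product `-2` with `v 0 0`.
  obtain rfl | rfl | hc4 : c = 2 ∨ c = 3 ∨ 4 ≤ c := by omega
  · refine Q.no_exceptional (v 0 0 + v 0 1 - k') (sub_mem (add_mem (Q.v_mem 0 0) (Q.v_mem 0 1)) hmem)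
      ?_ ?_
    · simp only [map_add, map_sub, LinearMap.add_apply, LinearMap.sub_apply, hv, hkv, hvk, hkk]
      rfl
    · simp only [map_add, map_sub, LinearMap.add_apply, LinearMap.sub_apply, Q.vh]
      omega
  · have hdeg : k3Form (k' - v 0 0) h = k3Form k' h - d := by
      rw [map_sub, LinearMap.sub_apply, Q.vh]
    have := Q.no_inadmissible (k' - v 0 0) (sub_mem hmem (Q.v_mem 0 0))
      (by
        simp only [map_sub, LinearMap.sub_apply, hv, hkv, hvk, hkk]
        rfl)
      (by omega) (by omega) 0 1
    simp [hkv, hv, gramAffineA3] at this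
  · have hdeg : k3Form (v 0 0 - k') h = d - k3Form k' h := by
      rw [map_sub, LinearMap.sub_apply, Q.vh]
    have hsq : k3Form (v 0 0 - k') (v 0 0 - k') = -2 := by
      simp only [map_sub, LinearMap.sub_apply, hv, hkv, hvk, hkk]
      rfl
    have hle : k3Form k' h ≤ d := by nlinarith
    have hS := sub_mem (Q.v_mem 0 0) hmem
    rcases hle.eq_or_lt with heq | hlt
    · exact Q.no_exceptional _ hS hsq (by omega)
    · have := Q.no_inadmissible _ hS hsq (by omega) (by omega) 0 0
      simp [hkv, hv, gramAffineA3] at this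

/-- Two pairs of opposite vertices are not congruent modulo two and the fibre class. -/
theorem opposite_ne_two_smul_add (Q : IsSixQuadrangles S v h k d) {i j : Fin 6} (hij : i ≠ j)
    (y : K3Lattice) (w : ℤ) : v i 0 + v i 2 + (v j 0 + v j 2) ≠ (2 : ℤ) • y + w • k := by
  intro he
  have hy : (2 : ℤ) • y = v i 0 + v i 2 + (v j 0 + v j 2) - w • k := eq_sub_of_add_eq he.symm
  have hyS : y ∈ S := by
    refine Q.primitive 2 y two_ne_zero (hy ▸ ?_)
    exact sub_mem (add_mem (add_mem (Q.v_mem _ _) (Q.v_mem _ _))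
      (add_mem (Q.v_mem _ _) (Q.v_mem _ _))) (S.smul_mem w Q.k_mem)
  have hprod : ∀ x, 2 * k3Form y x = k3Form (v i 0) x + k3Form (v i 2) x +
      (k3Form (v j 0) x + k3Form (v j 2) x) - w * k3Form k x := fun x => by
    rw [← smul_eq_mul, ← LinearMap.smul_apply, ← map_smul, hy]
    simp only [map_add, map_sub, map_smul, LinearMap.add_apply, LinearMap.sub_apply,
      LinearMap.smul_apply, smul_eq_mul]
  have hyh := hprod h
  have hyk := hprod k
  have hy0 := hprod (v i 0)
  have hy2 := hprod (v i 2)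
  have hy0' := hprod (v j 0)
  have hy2' := hprod (v j 2)
  have hyy := hprod y
  rw [k3Form_comm (v i 0) y, k3Form_comm (v i 2) y, k3Form_comm (v j 0) y, k3Form_comm (v j 2) y,
    k3Form_comm k y] at hyy
  simp only [Q.vh, Q.kh, Q.vk, Q.kv, Q.kk, Q.vv, if_true, if_neg hij, if_neg hij.symm,
    gramAffineA3] at hyh hyk hy0 hy2 hy0' hy2'
  simp at hyk hy0 hy2 hy0' hy2'
  rw [hyk, mul_zero] at hyy
  have hky : k3Form k y = 0 := by rw [k3Form_comm, hyk]
  -- Here `y² = -2` and `y · h = 2d(1 - w)`. Adding `m • k` brings the degree to `2d` or `0`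
  -- according to the parity of `w`; in the first case, subtracting `v i 0 + v i 2` brings it to 0
  -- and keeps the square.
  obtain ⟨m, rfl | rfl⟩ := Int.even_or_odd' w
  · refine Q.no_exceptional (y + m • k - v i 0 - v i 2) (sub_mem (sub_mem (add_mem hyS
      (S.smul_mem m Q.k_mem)) (Q.v_mem _ _)) (Q.v_mem _ _)) ?_ ?_
    · simp only [map_add, map_sub, map_smul, LinearMap.add_apply, LinearMap.sub_apply,
        LinearMap.smul_apply, smul_eq_mul, Q.vk, Q.kv, Q.kk, Q.vv, if_true, hyk, hky,
        k3Form_comm _ y, gramAffineA3]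
      simp
      omega
    · simp only [map_add, map_sub, map_smul, LinearMap.add_apply, LinearMap.sub_apply,
        LinearMap.smul_apply, smul_eq_mul, Q.vh, Q.kh]
      linarith
  · refine Q.no_exceptional (y + m • k) (add_mem hyS (S.smul_mem m Q.k_mem)) ?_ ?_
    · simp only [map_add, map_smul, LinearMap.add_apply, LinearMap.smul_apply, smul_eq_mul, Q.kk,
        hyk, hky]
      omega
    · simp only [map_add, map_smul, LinearMap.add_apply, LinearMap.smul_apply, smul_eq_mul, Q.kh]
      linarith

/-- The square of the polarization is not congruent to two modulo four. -/
theorem form_h_ne (Q : IsSixQuadrangles S v h k d) (hd : 0 < d) (hd_odd : Odd d) (m : ℤ) :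
    k3Form h h ≠ 4 * m + 2 := by
  intro hh
  obtain ⟨u₀, hu₀⟩ := Q.exists_form_k_eq_one hd
  obtain ⟨q, hq⟩ := even_k3Form u₀
  -- As `u₀² = 2q`, this shift makes `u` isotropic.
  let u := u₀ - q • k
  have huk : k3Form u k = 1 := by
    simp only [u, map_sub, map_smul, LinearMap.sub_apply, LinearMap.smul_apply, hu₀, Q.kk,
      smul_zero, sub_zero]
  have hku : k3Form k u = 1 := by rw [k3Form_comm, huk]
  have huu : k3Form u u = 0 := by
    have : k3Form k u₀ = 1 := by rw [k3Form_comm, hu₀]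
    simp only [u, map_sub, map_smul, LinearMap.sub_apply, LinearMap.smul_apply, hq, hu₀, this,
      Q.kk, smul_eq_mul]
    ring
  clear_value u
  -- Dropping one vertex of each quadrangle leaves `A₃`; subtracting a multiple of `k` makes it
  -- orthogonal to `u`.
  let a : Fin 6 → Fin 3 → K3Lattice := fun i j => v i j.castSucc - k3Form u (v i j.castSucc) • k
  have ha : IsSixA3U a k u :=
    { aa := fun i j i' j' => by
        simp only [a, map_sub, map_smul, LinearMap.sub_apply, LinearMap.smul_apply, Q.vv, Q.vk,
          Q.kv, Q.kk, smul_zero, sub_zero]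
        congr 1
        fin_cases j <;> fin_cases j' <;> rfl
      ka := fun i j => by simp only [a, map_sub, map_smul, Q.kv, Q.kk, smul_zero, sub_zero]
      ua := fun i j => by simp only [a, map_sub, map_smul, huk, smul_eq_mul, mul_one, sub_self]
      kk := Q.kk
      uu := huu
      ku := hku }
  have hhk : k3Form h k = 4 * d := by rw [k3Form_comm, Q.kh]
  have hhv : ∀ i j, k3Form h (v i j) = d := fun i j => by rw [k3Form_comm, Q.vh]
  -- `η` is the projection of `h` to `U^⊥`; its square is `h² - 8d (h · u)`, congruent to `h²`
  -- modulo 4.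
  refine ha.not_form_self_two_mod_four ?_ (η := h - (4 * d) • u - k3Form h u • k) hd_odd
    (s := fun i j => -d * k3Form u (v i j.castSucc)) ?_ ?_ ?_ (m - 2 * d * k3Form h u) ?_
  · rintro i j hij ⟨y, hy⟩
    refine Q.opposite_ne_two_smul_add hij y (k3Form u (v i 0) + k3Form u (v i 2) +
      (k3Form u (v j 0) + k3Form u (v j 2))) ?_
    rw [← hy]
    change _ = v i 0 - k3Form u (v i 0) • k + (v i 2 - k3Form u (v i 2) • k) +
      (v j 0 - k3Form u (v j 0) • k + (v j 2 - k3Form u (v j 2) • k)) + _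
    module
  · intro i j
    simp only [a, map_sub, map_smul, LinearMap.sub_apply, LinearMap.smul_apply, hhv, hhk, huk,
      Q.kv, Q.kk, smul_eq_mul]
    ring
  · simp only [map_sub, map_smul, LinearMap.sub_apply, LinearMap.smul_apply, hhk, huk, Q.kk,
      smul_eq_mul]
    ring
  · simp only [map_sub, map_smul, LinearMap.sub_apply, LinearMap.smul_apply, huu, hku,
      smul_eq_mul]
    ring
  · simp only [map_sub, map_smul, LinearMap.sub_apply, LinearMap.smul_apply, huu, hku, huk, hh,
      hhk, Q.kk, Q.kh, k3Form_comm u h, smul_eq_mul]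
    ring

end IsSixQuadrangles

/-! ### Geometric lattices of graphs -/

theorem not_isGraphGeometric_of_gram {W : Type*} [AddCommGroup W] [Module ℚ W] {B : BilinForm ℚ W}
    {S : Submodule ℤ W} {h : W} {n d : ℕ} (hd : 0 < d) (hd_odd : Odd d) (hn : Odd n)
    {g : Fin 6 × Fin 4 → W}
    (hgg : ∀ i j i' j', B (g (i, j)) (g (i', j')) =
      ((if i = i' then gramAffineA3 j j' else 0 : ℤ) : ℚ))
    (hhh : B h h = (2 * n : ℕ)) : ¬ IsGraphGeometric B S h d (Set.range g) := by
  rintro ⟨hroots, ⟨hadm, f, -, hform, hprim⟩, hinadm⟩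
  have hh := hadm.polarized.mem
  have hgh : ∀ i, B (g i) h = d := fun i => (hroots ⟨i, rfl⟩).2.2
  let v : Fin 6 → Fin 4 → S := fun i j => ⟨g (i, j), (hroots ⟨(i, j), rfl⟩).1⟩
  have hsum : ∀ i, v i 0 + v i 1 + v i 2 + v i 3 = v 0 0 + v 0 1 + v 0 2 + v 0 3 := by
    intro i
    rw [← sub_eq_zero]
    by_contra hne
    -- The difference of two fibre sums is isotropic and orthogonal to `h`, hence zero.
    refine (hadm.polarized.hyperbolic _ ?_ (fun h0 => hne (Subtype.ext h0))).ne ?_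
    · simp only [v, Submodule.coe_sub, Submodule.coe_add, map_sub, map_add, LinearMap.sub_apply,
        LinearMap.add_apply, hgh, sub_self]
    · simp only [v, Submodule.coe_sub, Submodule.coe_add, map_sub, map_add, LinearMap.sub_apply,
        LinearMap.add_apply, hgg]
      by_cases hi : i = 0
      · simp [hi]
      · simp [hi, Ne.symm hi, gramAffineA3]
        norm_num
  have Q : IsSixQuadrangles (LinearMap.range f) (fun i j => f (v i j)) (f ⟨h, hh⟩)
      (f (v 0 0 + v 0 1 + v 0 2 + v 0 3)) d :=
    { vv := fun i j i' j' => by exact_mod_cast (hform (v i j) (v i' j')).trans (hgg i j i' j')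
      vh := fun i j => by exact_mod_cast (hform (v i j) ⟨h, hh⟩).trans (hgh (i, j))
      sum_eq := fun i => by rw [← hsum i]; simp only [map_add]
      v_mem := fun i j => ⟨_, rfl⟩
      primitive := hprim
      no_exceptional := by
        rintro _ ⟨e, rfl⟩ he he0
        refine hadm.no_exceptional ⟨e, e.2, ?_, ?_⟩
        · rw [← hform, he]; norm_num
        · exact (hform e ⟨h, hh⟩).symm.trans (by rw [he0]; norm_num)
      no_inadmissible := by
        rintro _ ⟨e, rfl⟩ he hpos hlt i j
        by_contra! hneg
        obtain ⟨r, hr⟩ := Int.eq_ofNat_of_zero_le hpos.le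
        refine hinadm r (by omega) (by omega) ⟨e, ⟨e.2, ?_, ?_⟩, _, ⟨(i, j), rfl⟩, ?_⟩
        · rw [← hform, he]; norm_num
        · exact (hform e ⟨h, hh⟩).symm.trans (by rw [hr]; norm_num)
        · exact lt_of_eq_of_lt (hform e (v i j)).symm (by exact_mod_cast hneg) }
  obtain ⟨q, hq⟩ := hn
  refine Q.form_h_ne (by omega) (by exact_mod_cast hd_odd) q ?_
  have : k3Form (f ⟨h, hh⟩) (f ⟨h, hh⟩) = (2 * n : ℕ) := by
    exact_mod_cast (hform ⟨h, hh⟩ ⟨h, hh⟩).trans hhh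
  rw [this, hq]
  push_cast
  ring

namespace LoopFreeMultigraph

theorem fanoForm_fanoGen {V : Type*} [Fintype V] [DecidableEq V] (Γ : LoopFreeMultigraph V)
    (D d : ℕ) (i j : Option V) :
    Γ.fanoForm D d (Γ.fanoGen D d i) (Γ.fanoGen D d j) = Γ.gram D d i j := by
  change Γ.preForm D d (Pi.single i 1) (Pi.single j 1) = _
  rw [preForm, Matrix.toBilin'_single]

theorem gram_copies_affineA3 (D d : ℕ) (i : Fin 6) (j : Fin 4) (i' : Fin 6) (j' : Fin 4) :
    (copies 6 affineA3).gram D d (some (i, j)) (some (i', j')) =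
      ((if i = i' then gramAffineA3 j j' else 0 : ℤ) : ℚ) := by
  simp only [gram, copies, affineA3, Prod.mk.injEq]
  by_cases hi : i = i'
  · simp only [hi, true_and, if_true]
    fin_cases j <;> fin_cases j' <;> simp [gramAffineA3]
  · simp [hi]

end LoopFreeMultigraph

theorem mainTheorem9 (d : ℕ) (hd : 1 < d) (hd_odd : Odd d) :
    ∃ N : ℕ, ∀ n : ℕ, N ≤ n → Odd n →
      ¬ (LoopFreeMultigraph.copies 6 LoopFreeMultigraph.affineA3).IsSubgeometric (2 * n) d := by
  -- The obstruction depends only on `h²` modulo 4, so no lower bound on `n` is needed.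
  refine ⟨0, fun n _ hn hsub => ?_⟩
  obtain ⟨-, K, -, hgeom⟩ := hsub
  exact not_isGraphGeometric_of_gram (by omega) hd_odd hn
    (fun i j i' j' => (LoopFreeMultigraph.fanoForm_fanoGen _ _ _ _ _).trans
      (LoopFreeMultigraph.gram_copies_affineA3 _ _ i j i' j'))
    (LoopFreeMultigraph.fanoForm_fanoGen _ _ _ _ _) hgeom

end
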